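/- A partition $\lambda=(\lambda_1\ge\lambda_2\ge\cdots)$ has size $|\lambda|=\sum_i\lambda_i$ and length $\ell(\lambda)=\#\{i:\lambda_i\neq 0\}$; it is strict if $\lambda_i>\lambda_{i+1}$ whenever $\lambda_i\ne 0$. The southeast border of the Young diagram of a partition $\nu$ with $\ell(\nu)=a$ and $\nu_1=b$ is the lattice path from $(a,0)$ to $(0,b)$, made of north steps $(-1,0)$ and east steps $(0,1)$, that bounds the diagram from the southeast (the point $(i,j)$ lies $i$ units south and $j$ units east of the northwest corner of the diagram). An outward corner is a point of this path at which a north step is followed by an east step. The partition $\nu$ is balanced if all its outward corners lie on the line through $(a,0)$ and $(0,b)$. A strict partition $\lambda$ is shifted-balanced of Type (1) if there are integers $0\le k<n$ and a balanced (not necessarily strict) partition $\nu$ with $\ell(\nu)=\nu_1=k$ such that $\lambda=(n,n-1,\dots,1)+\nu$, the sum being taken part by part. For a strict partition $\lambda$ let $P_\lambda=\{[i,j] : 1\le i\le \ell(\lambda),\ i\le j\le i+\lambda_i-1\}$ be the set of boxes of its shifted Young diagram, with $[i,j]\le[i',j']$ iff $i\le i'$ and $j\le j'$. A shifted set-valued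 tableau $T$ of shape $\lambda$ assigns to each box $u\in P_\lambda$ a finite nonempty subset $T(u)$ of $\{1<1'<2<2'<\cdots\}$ such that $\max T(u)\le\min T(v)$ for all $u<v$ in $P_\lambda$, each unprimed integer appears at most once in each column, and each primed integer appears at most once in each row. Let $\mathbf{x}^T$ be the monomial that has one factor $x_i$ for each occurrence of $i$ or of $i'$ in $T$, and let $|T|$ be its degree. Then $T$ is standard if $\mathbf{x}^T=x_1x_2\cdots x_N$ for some $N$; it is barely set-valued if $\#T(u)=1$ for all boxes $u$ except a unique box $u_0$, for which $\#T(u_0)=2$; it is diagonally unprimed if no primed integer appears in a box $[i,i]$. Let $g^\lambda$ be the number of standard shifted set-valued tableaux of shape $\lambda$ with $\#T(u)=1$ for all $u$ and with no primed entries, and let \[ GP_\lambda(x_1,x_2,\ldots)=\sum_{T}(-1)^{|T|-|\lambda|}\,\mathbf{x}^T, \] where the sum is over all diagonally unprimed shifted set-valued tableaux $T$ of shape $\lambda$. Theorem. Let $\lambda$ be a strict partition that is shifted-balanced of Type (1). Then the number of diagonally unprimed standard shifted barely set-valued tableaux of shape $\lambda$ is \[ \lambda_1\,(|\lambda|+1)\,2^{|\lambda|-\ell(\lambda)-1}\,g^\lambda,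 \] and consequently \[ [x_1x_2\cdots x_{|\lambda|}x_{|\lambda|+1}]\,GP_\lambda(x_1,x_2,\ldots)=-\lambda_1\,(|\lambda|+1)\,2^{|\lambda|-\ell(\lambda)-1}\,g^\lambda . \] -/

import Mathlib

namespace ShiftedTab

/-! Partitions are represented by Mathlib's `YoungDiagram` (English notation, rows and columns
indexed from `0`): the part `λ_{i+1}` is `lam.rowLen i`, the length `ℓ(λ)` is `lam.colLen 0`, and
the size `|λ|` is `lam.card`. -/

/-- A strict partition: `λ_i > λ_{i+1}` whenever `λ_i ≠ 0`. -/
def IsStrict (lam : YoungDiagram) : Prop :=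
  ∀ i, lam.rowLen i ≠ 0 → lam.rowLen (i + 1) < lam.rowLen i

/-- The southeast border of a straight shape of height `a` and width `b` is the lattice path from
`(a, 0)` to `(0, b)` bounding it from the southeast (matrix coordinates: `(i, j)` is `i` units
south and `j` units east of the northwest corner). This says that the north step from
`(i + 1, j)` to `(i, j)` belongs to it. -/
def IsBorderNorthStep (nu : YoungDiagram) (i j : ℕ) : Prop :=
  i < nu.colLen 0 ∧ nu.rowLen i = j

/-- The east step from `(i, j)` to `(i, j + 1)` belongs to the southeast border. -/
def IsBorderEastStep (nu : YoungDiagram) (i j : ℕ) : Prop :=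
  j < nu.rowLen 0 ∧ nu.colLen j = i

/-- The southeast border has an outward corner (a north step followed by an east step) at the
lattice point `(i, j)`. A straight shape has no northwest outward corners. -/
def IsOutwardCorner (nu : YoungDiagram) (i j : ℕ) : Prop :=
  IsBorderNorthStep nu i j ∧ IsBorderEastStep nu i j

/-- A straight shape of height `a` and width `b` is balanced when each outward corner `(i, j)`
lies on the main anti-diagonal, the line `b * i + a * j = a * b` through `(a, 0)` and `(0, b)`. -/
def IsBalanced (nu : YoungDiagram) : Prop :=
  ∀ i j, IsOutwardCorner nu i j →
    nu.rowLen 0 * i + nu.colLen 0 * j = nu.colLen 0 * nu.rowLen 0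

/-- `λ = δ_n + ν` where `δ_n = (n, n-1, …, 1)` and `ν` is a balanced straight shape whose height
and width are both `k`, for some `0 ≤ k < n`. The truncated difference `n - i` is the part of
`δ_n` in row `i` (rows indexed from `0`). -/
def IsShiftedBalancedType1 (lam : YoungDiagram) : Prop :=
  ∃ (n k : ℕ) (nu : YoungDiagram), k < n ∧ nu.colLen 0 = k ∧ nu.rowLen 0 = k ∧ IsBalanced nu ∧
    ∀ i, lam.rowLen i = (n - i) + nu.rowLen i

/-- The boxes of the shifted Young diagram: row `i` (from `0`) is indented by `i`. -/
def shiftedCells (lam : YoungDiagram) : Finset (ℕ × ℕ) :=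
  lam.cells.image fun c => (c.1, c.1 + c.2)

/-- The poset of boxes of the shifted Young diagram, with the product order of `ℕ × ℕ`:
`u ≤ v` iff `v` is weakly southeast of `u`. -/
abbrev ShiftedBox (lam : YoungDiagram) : Type := {c : ℕ × ℕ // c ∈ shiftedCells lam}

/-- The alphabet `1 < 1' < 2 < 2' < ⋯` : `(i, false)` is `i` and `(i, true)` is `i'`, ordered
lexicographically. -/
abbrev Entry : Type := ℕ+ ×ₗ Bool

/-- The underlying positive integer of `i` or `i'`. -/
def Entry.val (e : Entry) : ℕ+ := (ofLex e).1

def Entry.IsPrimed (e : Entry) : Prop := (ofLex e).2 = true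

/-- A shifted set-valued filling. -/
structure SetValuedFilling (lam : YoungDiagram) where
  entries : ShiftedBox lam → Finset Entry
  nonempty : ∀ u, (entries u).Nonempty

namespace SetValuedFilling

variable {lam : YoungDiagram}

/-- The exponent vector of the monomial `x^T`; the variable indexed by `i : ℕ+` is `x_i`. -/
noncomputable def weight (T : SetValuedFilling lam) : ℕ+ →₀ ℕ :=
  ∑ u, ∑ e ∈ T.entries u, Finsupp.single e.val 1

/-- `|T|`, the degree of `x^T`. -/
noncomputable def size (T : SetValuedFilling lam) : ℕ := T.weight.degree

/-- A shifted set-valued tableau. The first condition says `max T(u) ≤ min T(v)` for `u < v`. -/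
structure IsTableau (T : SetValuedFilling lam) : Prop where
  max_le_min : ∀ u v, u < v → ∀ a ∈ T.entries u, ∀ b ∈ T.entries v, a ≤ b
  unprimed_col : ∀ u v : ShiftedBox lam, u.1.2 = v.1.2 →
    ∀ e : Entry, ¬ e.IsPrimed → e ∈ T.entries u → e ∈ T.entries v → u = v
  primed_row : ∀ u v : ShiftedBox lam, u.1.1 = v.1.1 →
    ∀ e : Entry, e.IsPrimed → e ∈ T.entries u → e ∈ T.entries v → u = v

end SetValuedFilling

/-- The exponent vector of `x_1 x_2 ⋯ x_N`. -/
noncomputable def firstVars (N : ℕ) : ℕ+ →₀ ℕ :=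
  ∑ i ∈ Finset.range N, Finsupp.single i.succPNat 1

namespace SetValuedFilling

variable {lam : YoungDiagram}

/-- `x^T = x_1 x_2 ⋯ x_N` for some `N`. -/
def IsStandard (T : SetValuedFilling lam) : Prop := ∃ N, T.weight = firstVars N

/-- Each box holds exactly one entry. -/
def IsSingleValued (T : SetValuedFilling lam) : Prop := ∀ u, (T.entries u).card = 1

/-- Each box holds exactly one entry, except for a unique box, which holds two. -/
def IsBarelySetValued (T : SetValuedFilling lam) : Prop :=
  ∃ u₀, (T.entries u₀).card = 2 ∧ ∀ u, u ≠ u₀ → (T.entries u).card = 1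

def IsUnprimed (T : SetValuedFilling lam) : Prop :=
  ∀ u, ∀ e ∈ T.entries u, ¬ Entry.IsPrimed e

def IsDiagonallyUnprimed (T : SetValuedFilling lam) : Prop :=
  ∀ u : ShiftedBox lam, u.1.1 = u.1.2 → ∀ e ∈ T.entries u, ¬ Entry.IsPrimed e

/-- There are finitely many fillings with a given monomial. -/
theorem finite_weight_eq (lam : YoungDiagram) (m : ℕ+ →₀ ℕ) :
    {T : SetValuedFilling lam | T.weight = m}.Finite := by
  classical
  let A : Finset Entry := (m.support ×ˢ (Finset.univ : Finset Bool)).map toLex.toEmbedding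
  have hA : ((Fintype.piFinset fun _ : ShiftedBox lam => A.powerset :
      Finset (ShiftedBox lam → Finset Entry)) : Set (ShiftedBox lam → Finset Entry)).Finite :=
    Finset.finite_toSet _
  refine Set.Finite.of_injOn (f := SetValuedFilling.entries) ?_ ?_ hA
  · intro T hT
    simp only [Set.mem_ofPred_eq] at hT
    simp only [Finset.mem_coe, Fintype.mem_piFinset, Finset.mem_powerset]
    intro u e he
    have hpos : m e.val ≠ 0 := by
      rw [← hT]
      simp only [weight, Finsupp.finsetSum_apply]
      intro h
      rw [Finset.sum_eq_zero_iff] at h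
      have h1 := h u (Finset.mem_univ u)
      rw [Finset.sum_eq_zero_iff] at h1
      simpa using h1 e he
    simp only [A, Finset.mem_map, Finset.mem_product, Finset.mem_univ, and_true]
    exact ⟨ofLex e, Finsupp.mem_support_iff.mpr hpos, rfl⟩
  · rintro ⟨f, hf⟩ _ ⟨g, hg⟩ _ h
    cases h
    rfl

end SetValuedFilling

open scoped Classical in
/-- The stable Grothendieck power series `GP_λ(x_1, x_2, …)`, the sum of `(-1)^(|T| - |λ|) x^T`
over all diagonally unprimed shifted set-valued tableaux `T` of shape `λ`. It is given
coefficientwise, each coefficient being a finite sum; no box is empty, so `|λ| ≤ |T|`. -/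
noncomputable def GP (lam : YoungDiagram) : MvPowerSeries ℕ+ ℤ := fun m =>
  ∑ T ∈ (SetValuedFilling.finite_weight_eq lam m).toFinset with
    T.IsTableau ∧ T.IsDiagonallyUnprimed, (-1) ^ (T.size - lam.card)

/-- `g^λ`, the number of unprimed standard shifted tableaux of shape `λ`. -/
noncomputable def numUnprimedStandard (lam : YoungDiagram) : ℕ :=
  Nat.card {T : SetValuedFilling lam //
    T.IsTableau ∧ T.IsStandard ∧ T.IsSingleValued ∧ T.IsUnprimed}

/-- The number of diagonally unprimed standard shifted barely set-valued tableaux of shape `λ`. -/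
noncomputable def numDiagUnprimedStandardBarely (lam : YoungDiagram) : ℕ :=
  Nat.card {T : SetValuedFilling lam //
    T.IsTableau ∧ T.IsStandard ∧ T.IsBarelySetValued ∧ T.IsDiagonallyUnprimed}

end ShiftedTab

/-! Write N = |λ|. A standard barely set-valued tableau amounts to a word of length N + 1 in the
boxes, compatible with their order, in which exactly one box p occurs twice, together with a free
choice of prime at every letter off the diagonal. Deleting the later copy of p leaves a linear
extension cut at a place where p is maximal in the order ideal of the letters before the cut.
Deleting the earlier copy leaves one cut where p is minimal in the complement of that ideal. Both
deletions are reversible. Let s(p) be 0 on the diagonal and 1 off it. If weights satisfy c(p) + d(p)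
= 2 · 2^s(p), then twice the count is 2^(N - ℓ(λ)) times the sum, over all g^λ linear extensions and
all N + 1 cuts, of c over the removable boxes plus d over the addable boxes
(`sum_extension_of_toggle`).

It remains to choose c and d so that this inner sum is the same for every ideal. With m = λ_1 and a
box (i, j) indexed from 0, take c = 2^s (i + j + 2 - m) and d = 2^s (m - i - j). If the addable
corners of the ideal in the unbounded shifted quadrant are all counted, the sum telescopes along the
boundary to m (`sum_corners_of_rowEnds`). The corners outside the diagram of λ are not really
counted, but Type (1) places them on the line i + j = m, where d vanishes
(`IsShiftedBalancedType1.isCorner_sum`, `sum_corners_eq`). -/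

namespace ShiftedTab

/-! ### Words with one repeated letter, and the toggle identity -/

/-- A word listing every element of a poset, in which smaller elements come before larger ones. -/
def IsExtension {P : Type*} [PartialOrder P] {M : ℕ} (w : Fin M → P) : Prop :=
  Function.Surjective w ∧ ∀ a b, w a < w b → a < b

/-- The letters of `w` in positions before `b`. -/
def prefixSet {P : Type*} {N : ℕ} (w : Fin N → P) (b : Fin (N + 1)) : Set P :=
  {p | ∃ j : Fin N, j.castSucc < b ∧ w j = p}

/-- `p` is a maximal element of `I`. -/
def IsRemovable {P : Type*} [PartialOrder P] (I : Set P) (p : P) : Prop :=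
  p ∈ I ∧ ∀ v, p < v → v ∉ I

/-- `p` is a minimal element of the complement of `I`. -/
def IsAddable {P : Type*} [PartialOrder P] (I : Set P) (p : P) : Prop :=
  p ∉ I ∧ ∀ v, v < p → v ∈ I

/-- Deleting one copy of a repeated letter leaves a surjection between sets of equal size, hence a
bijection. So there is no second repetition. -/
theorem exists_duplicate {P : Type*} {N : ℕ} [Fintype P] (hN : Fintype.card P = N)
    {w : Fin (N + 1) → P}
    (hw : Function.Surjective w) :
    ∃ a b, a < b ∧ w a = w b ∧ Function.Bijective (fun i => w (b.succAbove i)) ∧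
      ∀ a' b', a' < b' → w a' = w b' → a' = a ∧ b' = b := by
  have hninj : ¬ Function.Injective w := fun h => by
    have := Fintype.card_le_of_injective w h
    simp [hN] at this
  obtain ⟨a, b, hab, heq⟩ : ∃ a b, a < b ∧ w a = w b := by
    simp only [Function.Injective, not_forall] at hninj
    obtain ⟨a, b, heq, hne⟩ := hninj
    rcases lt_or_gt_of_ne hne with h | h
    · exact ⟨a, b, h, heq⟩
    · exact ⟨b, a, h, heq.symm⟩
  have hsurj : Function.Surjective (fun i => w (b.succAbove i)) := fun v => by
    obtain ⟨x, rfl⟩ := hw v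
    rcases Fin.eq_self_or_eq_succAbove b x with rfl | ⟨i, rfl⟩
    · obtain ⟨j, rfl⟩ := Fin.exists_succAbove_eq hab.ne
      exact ⟨j, heq⟩
    · exact ⟨i, rfl⟩
  have hbij := (Fintype.bijective_iff_surjective_and_card _).2 ⟨hsurj, by simp [hN]⟩
  have hne : ∀ x y, x ≠ b → y ≠ b → w x = w y → x = y := by
    intro x y hx hy hxy
    obtain ⟨i, rfl⟩ := Fin.exists_succAbove_eq hx
    obtain ⟨j, rfl⟩ := Fin.exists_succAbove_eq hy
    exact congrArg _ (hbij.1 hxy)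
  refine ⟨a, b, hab, heq, hbij, fun a' b' h' heq' => ?_⟩
  by_cases hb : b' = b
  · subst hb
    exact ⟨hne _ _ h'.ne hab.ne (heq'.trans heq.symm), rfl⟩
  · by_cases ha : a' = b
    · subst ha
      have := hne _ _ hb hab.ne (heq'.symm.trans heq.symm)
      subst this
      exact absurd hab h'.asymm
    · exact absurd (hne _ _ ha hb heq') h'.ne

section Words

variable {P : Type*} [PartialOrder P] {N : ℕ}

theorem IsExtension.isLowerSet_prefixSet {w : Fin N → P} (hw : IsExtension w) (b : Fin (N + 1)) :
    IsLowerSet (prefixSet w b) := by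
  rintro u v huv ⟨j, hj, rfl⟩
  obtain ⟨i, rfl⟩ := hw.1 v
  rcases huv.lt_or_eq with h | h
  · exact ⟨i, lt_trans (Fin.castSucc_lt_castSucc_iff.2 (hw.2 _ _ h)) hj, rfl⟩
  · exact ⟨j, hj, h.symm⟩

/-- A second copy of `p` can be inserted at `b`, after the first, exactly when nothing above `p` has
been listed yet; what lies below `p` already precedes its first copy. -/
theorem isExtension_insertNth_later (b : Fin (N + 1)) (p : P) (w : Fin N → P) :
    (IsExtension (b.insertNth p w : Fin (N + 1) → P) ∧
      ∃ a < b, (b.insertNth p w : Fin (N + 1) → P) a = p) ↔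
    IsExtension w ∧ IsRemovable (prefixSet w b) p := by
  constructor
  · rintro ⟨⟨hs, ho⟩, a, hab, ha⟩
    obtain ⟨j, rfl⟩ := Fin.exists_succAbove_eq hab.ne
    rw [Fin.insertNth_apply_succAbove] at ha
    have hj : j.castSucc < b := (Fin.succAbove_lt_iff_castSucc_lt b j).1 hab
    refine ⟨⟨fun v => ?_, fun x y hxy => ?_⟩, ⟨j, hj, ha⟩, ?_⟩
    · obtain ⟨x, hx⟩ := hs v
      rcases Fin.eq_self_or_eq_succAbove b x with rfl | ⟨i, rfl⟩
      · exact ⟨j, by simpa [ha] using hx⟩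
      · exact ⟨i, by simpa using hx⟩
    · have := ho (b.succAbove x) (b.succAbove y) (by simpa using hxy)
      simpa using this
    · rintro v hv ⟨i, hi, rfl⟩
      have := ho b (b.succAbove i) (by simpa using hv)
      exact absurd this (not_lt.2 ((Fin.succAbove_lt_iff_castSucc_lt b i).2 hi).le)
  · rintro ⟨⟨hs, ho⟩, ⟨j, hj, ha⟩, hmax⟩
    refine ⟨⟨fun v => ?_, fun x y hxy => ?_⟩, b.succAbove j,
      (Fin.succAbove_lt_iff_castSucc_lt b j).2 hj, by simpa using ha⟩
    · obtain ⟨x, rfl⟩ := hs v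
      exact ⟨b.succAbove x, by simp⟩
    · rcases Fin.eq_self_or_eq_succAbove b x with rfl | ⟨i, rfl⟩
      · rcases Fin.eq_self_or_eq_succAbove x y with rfl | ⟨k, rfl⟩
        · exact absurd hxy (lt_irrefl _)
        simp only [Fin.insertNth_apply_same, Fin.insertNth_apply_succAbove] at hxy
        by_contra hcon
        have h1 : x.succAbove k < x := lt_of_le_of_ne (not_lt.1 hcon) (Fin.succAbove_ne _ _)
        exact hmax _ hxy ⟨k, (Fin.succAbove_lt_iff_castSucc_lt x k).1 h1, rfl⟩
      · rcases Fin.eq_self_or_eq_succAbove b y with rfl | ⟨k, rfl⟩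
        · simp only [Fin.insertNth_apply_same, Fin.insertNth_apply_succAbove] at hxy
          have h1 := ho i j (ha ▸ hxy)
          exact (Fin.succAbove_lt_iff_castSucc_lt _ _).2
            (lt_trans (Fin.castSucc_lt_castSucc_iff.2 h1) hj)
        · simp only [Fin.insertNth_apply_succAbove] at hxy
          simpa using ho _ _ hxy

/-- The dual of the previous insertion. Injectivity is needed here because an addable `p` must be
absent from the prefix, so its only other copy has to lie after `b`. -/
theorem isExtension_insertNth_earlier (b : Fin (N + 1)) (p : P) {w : Fin N → P}
    (hinj : IsExtension w → Function.Injective w) :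
    (IsExtension (b.insertNth p w : Fin (N + 1) → P) ∧
      ∃ a > b, (b.insertNth p w : Fin (N + 1) → P) a = p) ↔
    IsExtension w ∧ IsAddable (prefixSet w b) p := by
  have hlt (i : Fin N) : b < b.succAbove i ↔ ¬ i.castSucc < b := by
    rw [← Fin.succAbove_lt_iff_castSucc_lt, not_lt]
    exact ⟨le_of_lt, fun h => lt_of_le_of_ne h (Fin.succAbove_ne b i).symm⟩
  constructor
  · rintro ⟨⟨hs, ho⟩, a, hab, ha⟩
    obtain ⟨j, rfl⟩ := Fin.exists_succAbove_eq (ne_of_gt hab)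
    rw [Fin.insertNth_apply_succAbove] at ha
    have hw : IsExtension w := by
      refine ⟨fun v => ?_, fun x y hxy => ?_⟩
      · obtain ⟨x, hx⟩ := hs v
        rcases Fin.eq_self_or_eq_succAbove b x with rfl | ⟨i, rfl⟩
        · exact ⟨j, by simpa [ha] using hx⟩
        · exact ⟨i, by simpa using hx⟩
      · have := ho (b.succAbove x) (b.succAbove y) (by simpa using hxy)
        simpa using this
    refine ⟨hw, ?_, fun v hv => ?_⟩
    · rintro ⟨i, hi, hip⟩
      obtain rfl := hinj hw (hip.trans ha.symm)
      exact (hlt i).1 hab hi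
    · obtain ⟨i, rfl⟩ := hw.1 v
      have := ho (b.succAbove i) b (by simpa using hv)
      exact ⟨i, (Fin.succAbove_lt_iff_castSucc_lt b i).1 this, rfl⟩
  · rintro ⟨⟨hs, ho⟩, hp, hmin⟩
    obtain ⟨j, hj⟩ := hs p
    have hjb : ¬ j.castSucc < b := fun h => hp ⟨j, h, hj⟩
    refine ⟨⟨fun v => ?_, fun x y hxy => ?_⟩, b.succAbove j, (hlt j).2 hjb, by simpa using hj⟩
    · obtain ⟨x, rfl⟩ := hs v
      exact ⟨b.succAbove x, by simp⟩
    · rcases Fin.eq_self_or_eq_succAbove b y with rfl | ⟨k, rfl⟩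
      · rcases Fin.eq_self_or_eq_succAbove y x with rfl | ⟨i, rfl⟩
        · exact absurd hxy (lt_irrefl _)
        simp only [Fin.insertNth_apply_same, Fin.insertNth_apply_succAbove] at hxy
        by_contra hcon
        have h1 := (hlt i).1 (lt_of_le_of_ne (not_lt.1 hcon) (Fin.succAbove_ne y i).symm)
        obtain ⟨l, hl, hli⟩ := hmin _ hxy
        obtain rfl | hne := eq_or_ne l i
        · exact h1 hl
        · exact hne (hinj ⟨hs, ho⟩ hli)
      · rcases Fin.eq_self_or_eq_succAbove b x with rfl | ⟨i, rfl⟩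
        · simp only [Fin.insertNth_apply_same, Fin.insertNth_apply_succAbove] at hxy
          have h1 := ho j k (hj ▸ hxy)
          exact (hlt k).2 fun h => hjb (lt_trans (Fin.castSucc_lt_castSucc_iff.2 h1) h)
        · simp only [Fin.insertNth_apply_succAbove] at hxy
          simpa using ho _ _ hxy

open scoped Classical in
-- Each word with repeated letter `p` is charged `c p` at its later copy and `d p` at its earlier
-- one. Deleting the charged copy turns the total into a sum over linear extensions and their N + 1
-- cuts, where each prefix ideal contributes `m`.
theorem sum_extension_of_toggle [Fintype P] (hN : Fintype.card P = N) (s : P → ℕ) (c d : P → ℤ)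
    (m : ℤ) (hcd : ∀ p, c p + d p = 2 * 2 ^ s p)
    (hm : ∀ I : Set P, IsLowerSet I →
      ∑ p, (if IsRemovable I p then c p else 0) + ∑ p, (if IsAddable I p then d p else 0) = m) :
    2 * ∑ w : Fin (N + 1) → P with IsExtension w, (2 : ℤ) ^ ∑ a, s (w a) =
      2 ^ (∑ p, s p) * ((Finset.univ.filter (IsExtension (P := P) (M := N))).card * ((N + 1) * m)) := by
  have key : ∀ w : Fin (N + 1) → P, IsExtension w →
      2 * (2 : ℤ) ^ ∑ a, s (w a) = 2 ^ (∑ p, s p) *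
        (∑ b, (if ∃ a < b, w a = w b then c (w b) else 0) +
          ∑ b, (if ∃ a > b, w a = w b then d (w b) else 0)) := by
    intro w hw
    obtain ⟨a, b, hab, heq, hbij, huniq⟩ := exists_duplicate hN hw.1
    have h1 : ∑ i, s (w i) = s (w b) + ∑ p, s p := by
      rw [Fin.sum_univ_succAbove _ b]
      congr 1
      exact Function.Bijective.sum_comp hbij s
    have h2 : ∑ x, (if ∃ a < x, w a = w x then c (w x) else 0) = c (w b) := by
      rw [Finset.sum_eq_single b, if_pos ⟨a, hab, heq⟩]
      · rintro x - hx
        exact if_neg fun ⟨y, hy, hyx⟩ => hx (huniq _ _ hy hyx).2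
      · simp
    have h3 : ∑ x, (if ∃ a > x, w a = w x then d (w x) else 0) = d (w b) := by
      rw [Finset.sum_eq_single a, if_pos ⟨b, hab, heq.symm⟩, heq]
      · rintro x - hx
        exact if_neg fun ⟨y, hy, hyx⟩ => hx (huniq _ _ hy hyx.symm).1
      · simp
    rw [h1, h2, h3, hcd, pow_add]
    ring
  have hinj : ∀ w : Fin N → P, IsExtension w → Function.Injective w := fun w hw =>
    ((Fintype.bijective_iff_surjective_and_card _).2 ⟨hw.1, by simp [hN]⟩).1
  have hc : ∀ b, ∑ w : Fin (N + 1) → P with IsExtension w,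
      (if ∃ a < b, w a = w b then c (w b) else 0) =
      ∑ w : Fin N → P with IsExtension w, ∑ p, if IsRemovable (prefixSet w b) p then c p else 0 := by
    intro b
    -- A word is split into its letter at `b` and the word left when position `b` is deleted.
    rw [Finset.sum_filter, Finset.sum_filter, ← (Fin.insertNthEquiv (fun _ => P) b).sum_comp,
      Fintype.sum_prod_type, Finset.sum_comm]
    refine Finset.sum_congr rfl fun w _ => ?_
    have hE (p : P) : Fin.insertNthEquiv (fun _ => P) b (p, w) = b.insertNth p w := rfl
    simp only [← ite_and, hE, Fin.insertNth_apply_same,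
      isExtension_insertNth_later]
    split_ifs with h <;> simp [h]
  have hd : ∀ b, ∑ w : Fin (N + 1) → P with IsExtension w,
      (if ∃ a > b, w a = w b then d (w b) else 0) =
      ∑ w : Fin N → P with IsExtension w, ∑ p, if IsAddable (prefixSet w b) p then d p else 0 := by
    intro b
    rw [Finset.sum_filter, Finset.sum_filter, ← (Fin.insertNthEquiv (fun _ => P) b).sum_comp,
      Fintype.sum_prod_type, Finset.sum_comm]
    refine Finset.sum_congr rfl fun w _ => ?_
    have hE (p : P) : Fin.insertNthEquiv (fun _ => P) b (p, w) = b.insertNth p w := rfl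
    simp only [← ite_and, hE, Fin.insertNth_apply_same,
      isExtension_insertNth_earlier b _ (hinj w)]
    split_ifs with h <;> simp [h]
  rw [Finset.mul_sum, Finset.sum_congr rfl fun w hw => key w (Finset.mem_filter.1 hw).2,
    ← Finset.mul_sum, Finset.sum_add_distrib, Finset.sum_comm, Finset.sum_congr rfl fun b _ => hc b,
    Finset.sum_comm (s := Finset.univ.filter _), Finset.sum_congr rfl fun b _ => hd b,
    ← Finset.sum_add_distrib]
  simp only [← Finset.sum_add_distrib]
  congr 1
  rw [Finset.sum_congr rfl fun b _ => Finset.sum_congr rfl fun w hw => by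
    rw [Finset.sum_add_distrib,
      hm _ ((Finset.mem_filter.1 hw).2.isLowerSet_prefixSet b)]]
  simp
  ring

end Words

/-! ### Standard fillings as words with primes -/

section WordTableaux

variable {lam : YoungDiagram} {M : ℕ}

/-- The filling in which the value `a + 1` sits in box `w a` and is primed when `ε a`. -/
def wordFilling (w : Fin M → ShiftedBox lam) (hw : Function.Surjective w) (ε : Fin M → Bool) :
    SetValuedFilling lam where
  entries u := (Finset.univ.filter fun a : Fin M => w a = u).image
    fun a : Fin M => (toLex ((a : ℕ).succPNat, ε a) : Entry)
  nonempty u := by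
    obtain ⟨a, rfl⟩ := hw u
    exact ⟨_, Finset.mem_image_of_mem _ (Finset.mem_filter.2 ⟨Finset.mem_univ a, rfl⟩)⟩

theorem mem_wordFilling {w : Fin M → ShiftedBox lam} {hw : Function.Surjective w}
    {ε : Fin M → Bool} {u : ShiftedBox lam} {e : Entry} :
    e ∈ (wordFilling w hw ε).entries u ↔ ∃ a : Fin M, w a = u ∧ toLex ((a : ℕ).succPNat, ε a) = e := by
  simp [wordFilling]

theorem succPNat_val_injective : Function.Injective fun a : Fin M => (a : ℕ).succPNat := by
  intro a b h
  exact Fin.ext (Nat.succPNat_injective h)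

theorem weight_wordFilling (w : Fin M → ShiftedBox lam) (hw : Function.Surjective w)
    (ε : Fin M → Bool) : (wordFilling w hw ε).weight = firstVars M := by
  classical
  have h : ∀ u, ∑ e ∈ (wordFilling w hw ε).entries u, Finsupp.single e.val 1 =
      ∑ a : Fin M with w a = u, Finsupp.single (a : ℕ).succPNat 1 := fun u => by
    simp only [wordFilling]
    rw [Finset.sum_image]
    · rfl
    intro a _ b _ hab
    exact succPNat_val_injective (congrArg (fun e : Entry => e.val) hab)
  simp only [SetValuedFilling.weight, h]
  rw [Finset.sum_fiberwise, firstVars, Finset.sum_range]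

/-- No entry lies in two boxes, so the row and column conditions hold trivially and only the order
condition remains. -/
theorem isTableau_wordFilling {w : Fin M → ShiftedBox lam} (hw : IsExtension w)
    (ε : Fin M → Bool) : (wordFilling w hw.1 ε).IsTableau := by
  have huniq : ∀ u v, ∀ e ∈ (wordFilling w hw.1 ε).entries u,
      e ∈ (wordFilling w hw.1 ε).entries v → u = v := by
    intro u v e hu hv
    obtain ⟨a, rfl, rfl⟩ := mem_wordFilling.1 hu
    obtain ⟨b, rfl, hb⟩ := mem_wordFilling.1 hv
    rw [succPNat_val_injective (congrArg (fun e : Entry => e.val) hb)]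
  refine ⟨fun u v huv e he f hf => ?_, fun u v _ e _ => huniq u v e, fun u v _ e _ => huniq u v e⟩
  obtain ⟨a, rfl, rfl⟩ := mem_wordFilling.1 he
  obtain ⟨b, rfl, rfl⟩ := mem_wordFilling.1 hf
  exact (Prod.Lex.toLex_lt_toLex.2 (Or.inl (Nat.succPNat_strictMono (hw.2 _ _ huv)))).le

theorem wordFilling_injective {w w' : Fin M → ShiftedBox lam} {hw : Function.Surjective w}
    {hw' : Function.Surjective w'} {ε ε' : Fin M → Bool}
    (h : wordFilling w hw ε = wordFilling w' hw' ε') : w = w' ∧ ε = ε' := by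
  have key : ∀ a, w a = w' a ∧ ε a = ε' a := by
    intro a
    have ha : toLex ((a : ℕ).succPNat, ε a) ∈ (wordFilling w hw ε).entries (w a) :=
      mem_wordFilling.2 ⟨a, rfl, rfl⟩
    rw [h] at ha
    obtain ⟨b, hb, hab⟩ := mem_wordFilling.1 ha
    obtain rfl := succPNat_val_injective (congrArg (fun e : Entry => e.val) hab)
    exact ⟨hb.symm, (congrArg (fun e : Entry => (ofLex e).2) hab).symm⟩
  exact ⟨funext fun a => (key a).1, funext fun a => (key a).2⟩

theorem firstVars_apply (a : ℕ) :
    firstVars M a.succPNat = if a < M then 1 else 0 := by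
  simp [firstVars, Finsupp.finsetSum_apply, Finsupp.single_apply]

/-- Every exponent of the weight is 0 or 1, so each value up to `M` occurs in a single box with a
single choice of prime; these are the letter and the bit of the word. -/
theorem exists_wordFilling {T : SetValuedFilling lam} (hT : T.IsTableau)
    (hM : T.weight = firstVars M) :
    ∃ (w : Fin M → ShiftedBox lam) (hw : IsExtension w) (ε : Fin M → Bool),
      T = wordFilling w hw.1 ε := by
  classical
  have hval : ∀ i : ℕ, ((Finset.univ.sigma fun u => T.entries u).filter
      fun x => x.2.val = i.succPNat).card = if i < M then 1 else 0 := by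
    intro i
    rw [← firstVars_apply, ← hM]
    simp only [SetValuedFilling.weight, Finsupp.finsetSum_apply, Finsupp.single_apply]
    rw [Finset.card_filter, Finset.sum_sigma]
  have hex : ∀ a : Fin M, ∃ x : ShiftedBox lam × Entry, x.2 ∈ T.entries x.1 ∧
      x.2.val = (a : ℕ).succPNat ∧
      ∀ u, ∀ e ∈ T.entries u, e.val = (a : ℕ).succPNat → u = x.1 ∧ e = x.2 := by
    intro a
    have := hval a
    rw [if_pos a.2, Finset.card_eq_one] at this
    obtain ⟨⟨u, e⟩, hue⟩ := this
    have h0 : (⟨u, e⟩ : (_ : ShiftedBox lam) × Entry) ∈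
      (Finset.univ.sigma fun u => T.entries u).filter fun x => x.2.val = (a : ℕ).succPNat := by
      rw [hue]; simp
    simp only [Finset.mem_filter, Finset.mem_sigma, Finset.mem_univ, true_and] at h0
    refine ⟨(u, e), h0.1, h0.2, fun v f hf hfa => ?_⟩
    have h1 : (⟨v, f⟩ : (_ : ShiftedBox lam) × Entry) ∈
      (Finset.univ.sigma fun u => T.entries u).filter fun x => x.2.val = (a : ℕ).succPNat := by
      simp [hf, hfa]
    rw [hue, Finset.mem_singleton] at h1
    cases h1
    exact ⟨rfl, rfl⟩
  choose x hmem hxa huniq using hex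
  have hcov : ∀ u, ∀ e ∈ T.entries u, ∃ a, x a = (u, e) := by
    intro u e he
    have hlt : e.val.natPred < M := by
      by_contra hcon
      have := hval e.val.natPred
      rw [if_neg hcon, Finset.card_eq_zero] at this
      exact Finset.notMem_empty (⟨u, e⟩ : (_ : ShiftedBox lam) × Entry) (this ▸ by simp [he])
    refine ⟨⟨_, hlt⟩, ?_⟩
    obtain ⟨h1, h2⟩ := huniq ⟨_, hlt⟩ u e he (by simp)
    exact Prod.ext h1.symm h2.symm
  have hx2 : ∀ a : Fin M, toLex ((a : ℕ).succPNat, (ofLex (x a).2).2) = (x a).2 := fun a => by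
    rw [← hxa a]; rfl
  have hsurj : Function.Surjective fun a => (x a).1 := fun u => by
    obtain ⟨e, he⟩ := T.nonempty u
    obtain ⟨a, ha⟩ := hcov u e he
    exact ⟨a, congrArg Prod.fst ha⟩
  refine ⟨fun a => (x a).1, ⟨hsurj, fun a b hab => ?_⟩, fun a => (ofLex (x a).2).2, ?_⟩
  · have hle := hT.max_le_min _ _ hab _ (hmem a) _ (hmem b)
    rw [← hx2 a, ← hx2 b, Prod.Lex.toLex_le_toLex] at hle
    rcases hle with h | h
    · exact Nat.succPNat_lt_succPNat.1 h
    · have := succPNat_val_injective h.1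
      subst this
      exact absurd hab (lt_irrefl _)
  · have : T.entries = (wordFilling (fun a => (x a).1) hsurj fun a =>
        (ofLex (x a).2).2).entries := by
      funext u
      ext e
      rw [mem_wordFilling]
      constructor
      · intro he
        obtain ⟨a, ha⟩ := hcov u e he
        exact ⟨a, by rw [ha], by rw [hx2, ha]⟩
      · rintro ⟨a, rfl, rfl⟩
        rw [hx2]
        exact hmem a
    cases T
    cases this
    rfl

end WordTableaux

/-! ### Corner sums of order ideals -/

/-- The rows of a lower set of a shifted diagram, row `i` filling the columns from `i` to `e i - 1`:
the corners, weighted linearly by position, have constant total weight. -/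
theorem sum_corners_of_rowEnds (e : ℕ → ℕ) (m : ℕ) (he : ∀ i, i ≤ e i)
    (hanti : ∀ i, i + 1 < e (i + 1) → e (i + 1) ≤ e i) (hm : e m = m) :
    ∑ i ∈ Finset.range (m + 1),
        (if i < e i ∧ ¬ (i + 1 < e i ∧ e i ≤ e (i + 1)) then
          (if e i = i + 1 then 1 else 2) * ((i : ℤ) + e i + 1 - m) else 0) +
      ∑ i ∈ Finset.range (m + 1), (if i = 0 ∨ e i < e (i - 1) then
          (if e i = i then 1 else 2) * ((m : ℤ) - i - e i) else 0) = m := by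
  rw [Finset.sum_range_succ, Finset.sum_range_succ' (n := m), if_neg (by omega), add_zero,
    ← add_assoc, ← Finset.sum_add_distrib]
  -- The removable corner of row i is paired with the addable corner of row i + 1. With F(i) = 2
  -- e(i) - m on nonempty rows and 0 on empty ones, the pair contributes F(i) - F(i + 1). Row m is
  -- empty, so F(m) = 0, and the addable corner of row 0 completes F(0) to m.
  have hstep : ∀ i ∈ Finset.range m,
      ((if i < e i ∧ ¬ (i + 1 < e i ∧ e i ≤ e (i + 1)) then
          (if e i = i + 1 then 1 else 2) * ((i : ℤ) + e i + 1 - m) else 0) +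
        (if i + 1 = 0 ∨ e (i + 1) < e (i + 1 - 1) then
          (if e (i + 1) = i + 1 then 1 else 2) * ((m : ℤ) - (i + 1 : ℕ) - e (i + 1)) else 0)) =
      (if i < e i then 2 * (e i : ℤ) - m else 0) -
        (if i + 1 < e (i + 1) then 2 * (e (i + 1) : ℤ) - m else 0) := by
    intro i _
    have h1 := he i
    have h2 := he (i + 1)
    have h3 := hanti i
    simp only [Nat.add_sub_cancel, Nat.add_eq_zero_iff, one_ne_zero, and_false, false_or]
    split_ifs <;> push_cast <;> omega
  rw [Finset.sum_congr rfl hstep,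
    Finset.sum_range_sub' (fun i => if i < e i then 2 * (e i : ℤ) - m else 0)]
  have := he 0
  simp only [hm, lt_irrefl, true_or, if_true, if_false]
  split_ifs <;> push_cast <;> omega

section Ideals

variable {lam : YoungDiagram}

theorem mem_shiftedCells {i j : ℕ} :
    (i, j) ∈ shiftedCells lam ↔ i ≤ j ∧ j < i + lam.rowLen i := by
  simp only [shiftedCells, Finset.mem_image, YoungDiagram.mem_cells, Prod.mk.injEq, Prod.exists,
    YoungDiagram.mem_iff_lt_rowLen]
  constructor
  · rintro ⟨a, b, h, rfl, rfl⟩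
    omega
  · rintro ⟨h1, h2⟩
    exact ⟨i, j - i, by omega, rfl, by omega⟩

theorem IsStrict.mem_shiftedCells_of_le (hs : IsStrict lam) {i j i' j' : ℕ}
    (h : (i', j') ∈ shiftedCells lam) (hi : i ≤ i') (hj : j ≤ j') (hij : i ≤ j) :
    (i, j) ∈ shiftedCells lam := by
  have key : ∀ k, lam.rowLen (i + k) ≠ 0 → i + k + lam.rowLen (i + k) ≤ i + lam.rowLen i := by
    intro k
    induction k with
    | zero => intro _; rfl
    | succ k ih =>
      intro hk
      have h1 : lam.rowLen (i + k) ≠ 0 := by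
        have := lam.rowLen_anti (i + k) (i + (k + 1)) (by omega)
        omega
      have := hs _ h1
      have := ih h1
      rw [show i + (k + 1) = i + k + 1 by omega] at *
      omega
  rw [mem_shiftedCells] at *
  obtain ⟨k, rfl⟩ := Nat.exists_eq_add_of_le hi
  have := key k (by omega)
  omega

/-- The end of row `i` of a set of boxes: the first column from `i` on missing from it. -/
theorem exists_rowEnds (hs : IsStrict lam) {I : Set (ShiftedBox lam)} (hI : IsLowerSet I) :
    ∃ e : ℕ → ℕ, (∀ i, i ≤ e i) ∧ (∀ i, i + 1 < e (i + 1) → e (i + 1) ≤ e i) ∧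
      (∀ i, e i ≤ i + lam.rowLen i) ∧ ∀ u : ShiftedBox lam, u ∈ I ↔ u.1.2 < e u.1.1 := by
  classical
  -- A column beyond the shape counts as missing, so the search for the row end always stops.
  have hex : ∀ i, ∃ j, i ≤ j ∧ ∀ h : (i, j) ∈ shiftedCells lam, (⟨(i, j), h⟩ : ShiftedBox lam) ∉ I :=
    fun i => ⟨i + lam.rowLen i, by omega, fun h => by have := mem_shiftedCells.1 h; omega⟩
  have hmem : ∀ i j (h : (i, j) ∈ shiftedCells lam),
      (⟨(i, j), h⟩ : ShiftedBox lam) ∈ I ↔ j < Nat.find (hex i) := by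
    intro i j h
    constructor
    · intro hj
      by_contra hcon
      have hle := not_lt.1 hcon
      have hsp := Nat.find_spec (hex i)
      have hP := hs.mem_shiftedCells_of_le h le_rfl hle hsp.1
      exact hsp.2 hP (hI (show (⟨(i, Nat.find (hex i)), hP⟩ : ShiftedBox lam) ≤ ⟨(i, j), h⟩ from
        Prod.mk_le_mk.2 ⟨le_rfl, hle⟩) hj)
    · intro hj
      by_contra hcon
      exact Nat.find_min (hex i) hj ⟨(mem_shiftedCells.1 h).1, fun _ => hcon⟩
  refine ⟨fun i => Nat.find (hex i), fun i => (Nat.find_spec (hex i)).1, fun i hi => ?_,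
    fun i => Nat.find_min' _ ⟨by omega, fun h => by have := mem_shiftedCells.1 h; omega⟩,
    fun u => hmem _ _ u.2⟩
  have hsub : Nat.find (hex (i + 1)) ≤ i + 1 + lam.rowLen (i + 1) :=
    Nat.find_min' _ ⟨by omega, fun h => by have := mem_shiftedCells.1 h; omega⟩
  beta_reduce at hi ⊢
  obtain ⟨j, hj⟩ : ∃ j, j + 1 = Nat.find (hex (i + 1)) := ⟨Nat.find (hex (i + 1)) - 1, by omega⟩
  have h1 : (i + 1, j) ∈ shiftedCells lam := mem_shiftedCells.2 (by omega)
  have h2 : (i, j) ∈ shiftedCells lam := hs.mem_shiftedCells_of_le h1 (by omega) le_rfl (by omega)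
  have h3 := (hmem _ _ h1).2 (by omega)
  have h4 := (hmem _ _ h2).1 (hI (show (⟨(i, j), h2⟩ : ShiftedBox lam) ≤ ⟨(i + 1, j), h1⟩ from
        Prod.mk_le_mk.2 ⟨by omega, le_rfl⟩) h3)
  omega

/-- Diagonal boxes count once and the others twice. -/
def boxWeight (c : ℕ × ℕ) : ℤ := if c.1 = c.2 then 1 else 2

open scoped Classical in
theorem sum_corners_eq (hs : IsStrict lam) {m : ℕ} (hm : lam.rowLen 0 = m)
    (hcorner : ∀ i j, i ≤ j → (i, j) ∉ shiftedCells lam →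
      (i = j ∨ (i, j - 1) ∈ shiftedCells lam) → (i = 0 ∨ (i - 1, j) ∈ shiftedCells lam) → i + j = m)
    {I : Set (ShiftedBox lam)} (hI : IsLowerSet I) :
    ∑ p, (if IsRemovable I p then boxWeight p.1 * ((p.1.1 : ℤ) + p.1.2 + 2 - m) else 0) +
      ∑ p, (if IsAddable I p then boxWeight p.1 * ((m : ℤ) - p.1.1 - p.1.2) else 0) = m := by
  obtain ⟨e, he, hanti, hle, hmem⟩ := exists_rowEnds hs hI
  have hltm : ∀ i j, (i, j) ∈ shiftedCells lam → j < m := fun i j h => by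
    have := hs.mem_shiftedCells_of_le h (Nat.zero_le i) le_rfl (Nat.zero_le j)
    have := mem_shiftedCells.1 this
    omega
  have hmemP : ∀ i j, i ≤ j → j < e i → (i, j) ∈ shiftedCells lam := fun i j hi hj => by
    have := hle i
    exact mem_shiftedCells.2 (by omega)
  have hem : ∀ i ≤ m, e i ≤ m := by
    intro i hi
    by_contra hcon
    have := hltm i (e i - 1) (hmemP _ _ (by omega) (by omega))
    omega
  -- The conjunct `p.1.1 ≤ p.1.2` is automatic for boxes; it makes the summand vanish off the
  -- diagram when the sum is extended to a square.
  have hrem : ∀ p : ShiftedBox lam, IsRemovable I p ↔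
      p.1.1 ≤ p.1.2 ∧ p.1.2 + 1 = e p.1.1 ∧ ¬ (p.1.1 + 1 < e p.1.1 ∧ e p.1.1 ≤ e (p.1.1 + 1)) := by
    rintro ⟨⟨i, j⟩, hij⟩
    have hij' := mem_shiftedCells.1 hij
    simp only [IsRemovable, hmem]
    constructor
    · rintro ⟨h1, h2⟩
      have h3 : j + 1 = e i := by
        by_contra hcon
        have hP := hmemP i (j + 1) (by omega) (by omega)
        exact h2 ⟨(i, j + 1), hP⟩ (Prod.mk_lt_mk.2 (Or.inr ⟨le_rfl, by omega⟩))
          (by simp only; omega)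
      refine ⟨hij'.1, h3, fun ⟨h4, h5⟩ => ?_⟩
      have hP := hmemP (i + 1) j (by omega) (by omega)
      exact h2 ⟨(i + 1, j), hP⟩ (Prod.mk_lt_mk.2 (Or.inl ⟨by omega, le_rfl⟩))
        (by simp only; omega)
    · rintro ⟨-, h1, h2⟩
      refine ⟨by omega, ?_⟩
      rintro ⟨⟨a, b⟩, hab⟩ hlt hv
      have hab' := mem_shiftedCells.1 hab
      have hle' : i ≤ a ∧ j ≤ b := Prod.mk_le_mk.1 hlt.le
      have hvI : (⟨(a, b), hab⟩ : ShiftedBox lam) ∈ I := (hmem _).2 hv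
      simp only at hv
      have hdown : ∀ x y (h : (x, y) ∈ shiftedCells lam), x ≤ a → y ≤ b → y < e x :=
        fun x y h hx hy => (hmem ⟨(x, y), h⟩).1
          (hI (show (⟨(x, y), h⟩ : ShiftedBox lam) ≤ ⟨(a, b), hab⟩ from
            Prod.mk_le_mk.2 ⟨hx, hy⟩) hvI)
      have hjb : b = j := by
        by_contra hcon
        have := hdown i (j + 1) (hs.mem_shiftedCells_of_le hab hle'.1 (by omega) (by omega))
          hle'.1 (by omega)
        omega
      have hia : i ≠ a := by
        rintro rfl
        subst hjb
        exact lt_irrefl _ hlt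
      have := hdown (i + 1) j (hs.mem_shiftedCells_of_le hab (by omega) hle'.2 (by omega))
        (by omega) hle'.2
      omega
  have hadd : ∀ p : ShiftedBox lam, IsAddable I p ↔ p.1.2 = e p.1.1 ∧
      (p.1.1 = 0 ∨ e p.1.1 < e (p.1.1 - 1)) := by
    rintro ⟨⟨i, j⟩, hij⟩
    have hij' := mem_shiftedCells.1 hij
    have hei := he i
    simp only [IsAddable, hmem]
    constructor
    · rintro ⟨h1, h2⟩
      have h3 : j = e i := by
        by_contra hcon
        have hP : (i, j - 1) ∈ shiftedCells lam := mem_shiftedCells.2 (by omega)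
        have := h2 ⟨(i, j - 1), hP⟩ (Prod.mk_lt_mk.2 (Or.inr ⟨le_rfl, by omega⟩))
        simp only at this
        omega
      refine ⟨h3, ?_⟩
      by_cases hi : i = 0
      · exact Or.inl hi
      have hP := hs.mem_shiftedCells_of_le hij (Nat.sub_le i 1) le_rfl (by omega)
      have := h2 ⟨(i - 1, j), hP⟩ (Prod.mk_lt_mk.2 (Or.inl ⟨by omega, le_rfl⟩))
      simp only at this
      omega
    · rintro ⟨h1, h2⟩
      refine ⟨by omega, ?_⟩
      rintro ⟨⟨a, b⟩, hab⟩ hlt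
      have hab' := mem_shiftedCells.1 hab
      have hle' : a ≤ i ∧ b ≤ j := Prod.mk_le_mk.1 hlt.le
      by_cases hai : a = i
      · subst hai
        have : b ≠ j := by rintro rfl; exact lt_irrefl _ hlt
        simp only
        omega
      · have hP := hmemP (i - 1) j (by omega) (by omega)
        exact (hmem ⟨(a, b), hab⟩).1 (hI (show (⟨(a, b), hab⟩ : ShiftedBox lam) ≤
          ⟨(i - 1, j), hP⟩ from Prod.mk_le_mk.2 ⟨by omega, hle'.2⟩)
            ((hmem _).2 (by simp only; omega)))
  have hsum : ∀ f : ℕ × ℕ → ℤ, (∀ i j, i ≤ m → (i, j) ∉ shiftedCells lam → f (i, j) = 0) →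
      ∑ p : ShiftedBox lam, f p.1 =
        ∑ i ∈ Finset.range (m + 1), ∑ j ∈ Finset.range (m + 1), f (i, j) := by
    intro f hf
    rw [← Finset.sum_product', Finset.sum_coe_sort (shiftedCells lam) f]
    refine Finset.sum_subset ?_ ?_
    · rintro ⟨i, j⟩ h
      have := hltm i j h
      have := mem_shiftedCells.1 h
      simp only [Finset.mem_product, Finset.mem_range]
      omega
    · rintro ⟨i, j⟩ h h'
      simp only [Finset.mem_product, Finset.mem_range] at h
      exact hf i j (by omega) h'
  have hmm : e m = m := le_antisymm (hem m le_rfl) (he m)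
  refine Eq.trans ?_ (sum_corners_of_rowEnds e m he hanti hmm)
  simp only [hrem, hadd]
  rw [hsum fun x => if x.1 ≤ x.2 ∧ x.2 + 1 = e x.1 ∧ ¬ (x.1 + 1 < e x.1 ∧ e x.1 ≤ e (x.1 + 1)) then
      boxWeight x * ((x.1 : ℤ) + x.2 + 2 - m) else 0,
    hsum fun x => if x.2 = e x.1 ∧ (x.1 = 0 ∨ e x.1 < e (x.1 - 1)) then
      boxWeight x * ((m : ℤ) - x.1 - x.2) else 0]
  · congr 1
    · refine Finset.sum_congr rfl fun i hi => ?_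
      have := hem i (by simpa [Nat.lt_succ_iff] using hi)
      rw [Finset.sum_eq_single (e i - 1)]
      · by_cases hie : i < e i
        · have h1 : e i - 1 + 1 = e i := by omega
          have h2 : i ≤ e i - 1 := by omega
          have h3 : i = e i - 1 ↔ e i = i + 1 := by omega
          have h4 : ((e i - 1 : ℕ) : ℤ) = e i - 1 := by omega
          simp only [boxWeight, h1, h2, h3, h4, hie, true_and]
          congr 2
          ring
        · rw [if_neg (by dsimp only; omega), if_neg (by omega)]
      · intro j _ hj
        exact if_neg fun h => by dsimp only at h; omega
      · intro h
        exact absurd (Finset.mem_range.2 (by omega)) h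
    · refine Finset.sum_congr rfl fun i hi => ?_
      have := hem i (by simpa [Nat.lt_succ_iff] using hi)
      rw [Finset.sum_eq_single (e i)]
      · simp [boxWeight, eq_comm]
      · intro j _ hj
        exact if_neg fun h => hj h.1
      · intro h
        exact absurd (Finset.mem_range.2 (by omega)) h
  -- An addable corner of the ideal lying outside the diagram is an addable corner of the whole
  -- shape, so its weight is zero.
  · intro i j _ hij
    by_cases h : j = e i ∧ (i = 0 ∨ e i < e (i - 1))
    · obtain ⟨rfl, h0⟩ := h
      have hi := he i
      have := hcorner i (e i) hi hij
        ((Nat.eq_or_lt_of_le hi).imp_right fun h => hmemP _ _ (by omega) (by omega))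
        (h0.imp_right fun h => hmemP _ _ (by omega) h)
      rw [show (m : ℤ) - i - e i = 0 by omega]
      simp
    · exact if_neg h
  · intro i j _ hij
    exact if_neg fun h => hij (hmemP i j h.1 (by dsimp only at h; omega))

/-- Row i < n ends at column n + ν_i, so below row 0 an addable corner of the shifted shape is an
outward corner of ν moved n columns east, or the point (k, n) where ν stops. Balance gives i + ν_i =
k in the first case, and n + k = λ_1. -/
theorem IsShiftedBalancedType1.isCorner_sum (hbal : IsShiftedBalancedType1 lam) {i j : ℕ}
    (hij : i ≤ j) (h : (i, j) ∉ shiftedCells lam) (hl : i = j ∨ (i, j - 1) ∈ shiftedCells lam)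
    (hu : i = 0 ∨ (i - 1, j) ∈ shiftedCells lam) : i + j = lam.rowLen 0 := by
  obtain ⟨n, k, nu, hkn, hcol, hrow, hb, hlam⟩ := hbal
  have hnu : ∀ a, nu.rowLen a ≠ 0 ↔ a < k := fun a => by
    rw [← hcol, ← YoungDiagram.mem_iff_lt_colLen, YoungDiagram.mem_iff_lt_rowLen]
    omega
  simp only [mem_shiftedCells, hlam] at h hl hu ⊢
  have hi := hnu i
  have hi' := hnu (i - 1)
  -- Since k < n, row n - 1 has a single box, which leaves no room for a corner in row n.
  have hin : i < n := by omega
  have hj : j = n + nu.rowLen i := by omega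
  rcases hu with rfl | hu
  · omega
  by_cases hik : i < k
  · have hlt : nu.rowLen i < nu.rowLen (i - 1) := by omega
    have hanti := nu.rowLen_anti 0 (i - 1) (Nat.zero_le _)
    have hc : nu.colLen (nu.rowLen i) = i := by
      apply le_antisymm
      · by_contra hcon
        have := YoungDiagram.mem_iff_lt_rowLen.1
          (YoungDiagram.mem_iff_lt_colLen.2 (not_le.1 hcon))
        omega
      · have := YoungDiagram.mem_iff_lt_colLen.1 (YoungDiagram.mem_iff_lt_rowLen.2 hlt)
        omega
    have := hb i (nu.rowLen i) ⟨⟨by omega, rfl⟩, by omega, hc⟩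
    rw [hrow, hcol, ← mul_add] at this
    have := Nat.eq_of_mul_eq_mul_left (by omega) this
    omega
  · omega

end Ideals

/-! ### Passing from tableaux to weighted words -/

section Counting

variable {lam : YoungDiagram}

theorem card_shiftedCells : (shiftedCells lam).card = lam.card := by
  rw [shiftedCells, Finset.card_image_of_injective, YoungDiagram.card]
  rintro ⟨a, b⟩ ⟨c, d⟩ h
  simp only [Prod.mk.injEq] at h ⊢
  omega

theorem card_shiftedBox : Fintype.card (ShiftedBox lam) = lam.card := by
  rw [Fintype.card_coe, card_shiftedCells]

/-- Each nonempty row contains exactly one diagonal box. -/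
theorem sum_offDiagonal_add_colLen :
    ∑ p : ShiftedBox lam, (if p.1.1 = p.1.2 then 0 else 1) + lam.colLen 0 = lam.card := by
  rw [Finset.sum_coe_sort (shiftedCells lam) fun p => if p.1 = p.2 then 0 else 1,
    ← card_shiftedCells, ← Finset.card_filter_add_card_filter_not (s := shiftedCells lam)
      (fun p => ¬ p.1 = p.2)]
  congr 1
  · rw [Finset.card_filter]
    exact Finset.sum_congr rfl fun p _ => by split_ifs <;> rfl
  · rw [← Finset.card_range (lam.colLen 0)]
    refine Finset.card_bij (fun i _ => (i, i)) ?_ ?_ ?_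
    · intro i hi
      rw [Finset.mem_range, ← YoungDiagram.mem_iff_lt_colLen, YoungDiagram.mem_iff_lt_rowLen] at hi
      simp only [Finset.mem_filter, mem_shiftedCells, not_not, and_true]
      omega
    · intro a _ b _ h
      exact congrArg Prod.fst h
    · rintro ⟨i, j⟩ h
      simp only [Finset.mem_filter, mem_shiftedCells, not_not] at h
      obtain ⟨h, rfl⟩ := h
      refine ⟨i, ?_, rfl⟩
      rw [Finset.mem_range, ← YoungDiagram.mem_iff_lt_colLen, YoungDiagram.mem_iff_lt_rowLen]
      omega

theorem degree_firstVars (M : ℕ) : (firstVars M).degree = M := by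
  simp [firstVars, map_sum]

theorem SetValuedFilling.size_eq_sum_card (T : SetValuedFilling lam) :
    T.size = ∑ u, (T.entries u).card := by
  simp [SetValuedFilling.size, SetValuedFilling.weight, map_sum]

theorem SetValuedFilling.one_le_card (T : SetValuedFilling lam) (u : ShiftedBox lam) :
    1 ≤ (T.entries u).card := Finset.card_pos.2 (T.nonempty u)

theorem SetValuedFilling.size_of_weight {T : SetValuedFilling lam} {M : ℕ}
    (h : T.weight = firstVars M) : T.size = M := by
  rw [SetValuedFilling.size, h, degree_firstVars]

theorem SetValuedFilling.isStandard_isSingleValued_iff {T : SetValuedFilling lam} :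
    T.IsStandard ∧ T.IsSingleValued ↔ T.weight = firstVars lam.card := by
  have hsum := T.size_eq_sum_card
  have hone : ∑ _u : ShiftedBox lam, 1 = lam.card := by simp [card_shiftedCells]
  constructor
  · rintro ⟨⟨N, hN⟩, h1⟩
    rw [size_of_weight hN, Finset.sum_congr rfl fun u _ => h1 u, hone] at hsum
    rw [hN, hsum]
  · intro h
    refine ⟨⟨_, h⟩, fun u => ?_⟩
    rw [size_of_weight h, ← hone] at hsum
    exact ((Finset.sum_eq_sum_iff_of_le fun u _ => T.one_le_card u).1 hsum u (Finset.mem_univ u)).symm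

/-- No box is empty, so a total of |λ| + 1 entries forces exactly one box to hold two. The weight
alone thus singles out these tableaux, which identifies the coefficient of `GP` up to sign. -/
theorem SetValuedFilling.isStandard_isBarelySetValued_iff {T : SetValuedFilling lam} :
    T.IsStandard ∧ T.IsBarelySetValued ↔ T.weight = firstVars (lam.card + 1) := by
  classical
  have hsum := T.size_eq_sum_card
  have hone : ∑ _u : ShiftedBox lam, 1 = lam.card := by simp [card_shiftedCells]
  constructor
  · rintro ⟨⟨N, hN⟩, u₀, h2, h1⟩
    have h : ∀ u, (T.entries u).card = 1 + if u = u₀ then 1 else 0 := fun u => by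
      split_ifs with hu
      · rw [hu, h2]
      · rw [h1 u hu]
    rw [size_of_weight hN, Finset.sum_congr rfl fun u _ => h u, Finset.sum_add_distrib, hone,
      Finset.sum_ite_eq', if_pos (Finset.mem_univ _)] at hsum
    rw [hN, hsum]
  · intro h
    refine ⟨⟨_, h⟩, ?_⟩
    have hsub : ∑ u, ((T.entries u).card - 1) = 1 := by
      have : ∑ u, ((T.entries u).card - 1) + ∑ _u : ShiftedBox lam, 1 = ∑ u, (T.entries u).card := by
        rw [← Finset.sum_add_distrib]
        exact Finset.sum_congr rfl fun u _ => Nat.sub_add_cancel (T.one_le_card u)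
      rw [size_of_weight h] at hsum
      omega
    obtain ⟨u₀, -, hu₀⟩ := Finset.exists_ne_zero_of_sum_ne_zero (hsub ▸ one_ne_zero)
    have hsplit := Finset.add_sum_erase Finset.univ (fun u => (T.entries u).card - 1)
      (Finset.mem_univ u₀)
    refine ⟨u₀, by omega, fun u hne => ?_⟩
    have h0 := Finset.sum_eq_zero_iff.1 (show ∑ u ∈ Finset.univ.erase u₀,
      ((T.entries u).card - 1) = 0 by omega) u (Finset.mem_erase.2 ⟨hne, Finset.mem_univ u⟩)
    have := T.one_le_card u
    omega

/-- `D` marks the boxes where primes are forbidden: all of them for g^λ, the diagonal ones for the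
barely set-valued count. -/
theorem card_tableaux_eq_card_words (M : ℕ) (D : ShiftedBox lam → Prop) :
    Nat.card {T : SetValuedFilling lam // T.IsTableau ∧ T.weight = firstVars M ∧
        ∀ u, D u → ∀ e ∈ T.entries u, ¬ e.IsPrimed} =
      Nat.card {x : (Fin M → ShiftedBox lam) × (Fin M → Bool) //
        IsExtension x.1 ∧ ∀ a, D (x.1 a) → x.2 a = false} := by
  symm
  refine Nat.card_congr (Equiv.ofBijective (fun x => ⟨wordFilling x.1.1 x.2.1.1 x.1.2,
    isTableau_wordFilling x.2.1 _, weight_wordFilling _ _ _, fun u hu e he => ?_⟩) ⟨?_, ?_⟩)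
  · obtain ⟨a, rfl, rfl⟩ := mem_wordFilling.1 he
    have := x.2.2 a hu
    simp [Entry.IsPrimed, this]
  · rintro ⟨⟨w, ε⟩, h⟩ ⟨⟨w', ε'⟩, h'⟩ heq
    obtain ⟨rfl, rfl⟩ := wordFilling_injective (hw := h.1.1) (hw' := h'.1.1)
      (congrArg Subtype.val heq)
    rfl
  · rintro ⟨T, hT, hM, hD⟩
    obtain ⟨w, hw, ε, rfl⟩ := exists_wordFilling hT hM
    refine ⟨⟨(w, ε), hw, fun a ha => ?_⟩, rfl⟩
    have := hD (w a) ha _ (mem_wordFilling.2 ⟨a, rfl, rfl⟩)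
    simpa [Entry.IsPrimed] using this

open scoped Classical in
theorem card_words (M : ℕ) (D : ShiftedBox lam → Prop) [DecidablePred D] :
    Nat.card {x : (Fin M → ShiftedBox lam) × (Fin M → Bool) //
        IsExtension x.1 ∧ ∀ a, D (x.1 a) → x.2 a = false} =
      ∑ w : Fin M → ShiftedBox lam with IsExtension w, 2 ^ ∑ a, (if D (w a) then 0 else 1) := by
  rw [Nat.card_eq_fintype_card, Fintype.card_subtype, Finset.card_filter, Fintype.sum_prod_type,
    Finset.sum_filter]
  refine Finset.sum_congr rfl fun w _ => ?_
  split_ifs with h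
  · simp only [h, true_and]
    rw [← Finset.card_filter, ← Finset.prod_pow_eq_pow_sum]
    have : (Finset.univ.filter fun ε : Fin M → Bool => ∀ a, D (w a) → ε a = false) =
        Fintype.piFinset fun a => if D (w a) then {false} else Finset.univ := by
      ext ε
      simp only [Finset.mem_filter, Finset.mem_univ, true_and, Fintype.mem_piFinset]
      refine forall_congr' fun a => ?_
      split_ifs with ha <;> simp [ha]
    rw [this, Fintype.card_piFinset]
    refine Finset.prod_congr rfl fun a _ => ?_
    split_ifs <;> simp
  · simp [h]

open scoped Classical in
theorem numUnprimedStandard_eq : numUnprimedStandard lam =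
    (Finset.univ.filter (IsExtension (P := ShiftedBox lam) (M := lam.card))).card := by
  have h := (card_tableaux_eq_card_words lam.card fun _ : ShiftedBox lam => True).trans
    (card_words _ fun _ => True)
  simp only [true_implies, if_true, Finset.sum_const_zero, pow_zero, ← Finset.card_eq_sum_ones] at h
  rw [← h]
  refine Nat.card_congr (Equiv.subtypeEquivRight fun T => ?_)
  rw [← SetValuedFilling.isStandard_isSingleValued_iff, and_assoc]
  rfl

open scoped Classical in
theorem numDiagUnprimedStandardBarely_eq : numDiagUnprimedStandardBarely lam =
    ∑ w : Fin (lam.card + 1) → ShiftedBox lam with IsExtension w,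
      2 ^ ∑ a, (if (w a).1.1 = (w a).1.2 then 0 else 1) := by
  rw [← card_words _ fun u : ShiftedBox lam => u.1.1 = u.1.2,
    ← card_tableaux_eq_card_words _ fun u : ShiftedBox lam => u.1.1 = u.1.2]
  refine Nat.card_congr (Equiv.subtypeEquivRight fun T => ?_)
  rw [← SetValuedFilling.isStandard_isBarelySetValued_iff, and_assoc]
  rfl

theorem coeff_GP_eq : MvPowerSeries.coeff (firstVars (lam.card + 1)) (GP lam) =
    -(numDiagUnprimedStandardBarely lam : ℤ) := by
  classical
  change GP lam (firstVars (lam.card + 1)) = _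
  rw [GP, Finset.sum_congr rfl (g := fun _ => -1)]
  · rw [Finset.sum_const, smul_neg, nsmul_one, numDiagUnprimedStandardBarely]
    congr 2
    rw [← Nat.card_eq_finsetCard]
    refine Nat.card_congr (Equiv.subtypeEquivRight fun T => ?_)
    simp only [Finset.mem_filter, Set.Finite.mem_toFinset, Set.mem_ofPred_eq]
    rw [← SetValuedFilling.isStandard_isBarelySetValued_iff]
    tauto
  · intro T hT
    simp only [Finset.mem_filter, Set.Finite.mem_toFinset, Set.mem_ofPred_eq] at hT
    rw [SetValuedFilling.size_of_weight hT.1]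
    simp

theorem two_mul_numDiagUnprimedStandardBarely (hs : IsStrict lam)
    (hbal : IsShiftedBalancedType1 lam) :
    2 * numDiagUnprimedStandardBarely lam = 2 ^ (lam.card - lam.colLen 0) *
      (numUnprimedStandard lam * ((lam.card + 1) * lam.rowLen 0)) := by
  classical
  have h := sum_extension_of_toggle card_shiftedBox
    (fun p : ShiftedBox lam => if p.1.1 = p.1.2 then 0 else 1)
    (fun p => boxWeight p.1 * ((p.1.1 : ℤ) + p.1.2 + 2 - lam.rowLen 0))
    (fun p => boxWeight p.1 * ((lam.rowLen 0 : ℤ) - p.1.1 - p.1.2)) (lam.rowLen 0)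
    (fun p => by simp only [boxWeight]; split_ifs <;> ring)
    (fun I hI => sum_corners_eq hs rfl (fun i j => hbal.isCorner_sum) hI)
  have hcard := sum_offDiagonal_add_colLen (lam := lam)
  rw [numDiagUnprimedStandardBarely_eq, numUnprimedStandard_eq, ← hcard, Nat.add_sub_cancel, hcard]
  exact_mod_cast h

end Counting
end ShiftedTab

theorem mainTheorem13 (lam : YoungDiagram) (hstrict : ShiftedTab.IsStrict lam)
    (hbal : ShiftedTab.IsShiftedBalancedType1 lam) :
    (ShiftedTab.numDiagUnprimedStandardBarely lam : ℚ) =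
        (lam.rowLen 0 : ℚ) * ((lam.card : ℚ) + 1) *
          (2 : ℚ) ^ ((lam.card : ℤ) - (lam.colLen 0 : ℤ) - 1) *
          (ShiftedTab.numUnprimedStandard lam : ℚ) ∧
      ((MvPowerSeries.coeff (ShiftedTab.firstVars (lam.card + 1)) (ShiftedTab.GP lam) : ℤ) : ℚ) =
        -((lam.rowLen 0 : ℚ) * ((lam.card : ℚ) + 1) *
          (2 : ℚ) ^ ((lam.card : ℤ) - (lam.colLen 0 : ℤ) - 1) *
          (ShiftedTab.numUnprimedStandard lam : ℚ)) := by
  have hle : lam.colLen 0 ≤ lam.card := by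
    have := ShiftedTab.sum_offDiagonal_add_colLen (lam := lam)
    omega
  have hcount : (ShiftedTab.numDiagUnprimedStandardBarely lam : ℚ) =
      (lam.rowLen 0 : ℚ) * ((lam.card : ℚ) + 1) *
        (2 : ℚ) ^ ((lam.card : ℤ) - (lam.colLen 0 : ℤ) - 1) *
        (ShiftedTab.numUnprimedStandard lam : ℚ) := by
    have h : (2 : ℚ) * ShiftedTab.numDiagUnprimedStandardBarely lam =
        2 ^ (lam.card - lam.colLen 0) *
          (ShiftedTab.numUnprimedStandard lam * ((lam.card + 1) * lam.rowLen 0)) := by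
      exact_mod_cast ShiftedTab.two_mul_numDiagUnprimedStandardBarely hstrict hbal
    -- The exponent is -1 for λ = (1), so the factor 1/2 is split off in ℚ.
    rw [← Nat.cast_sub hle, zpow_sub_one₀ two_ne_zero, zpow_natCast]
    linear_combination h / 2
  refine ⟨hcount, ?_⟩
  rw [ShiftedTab.coeff_GP_eq, ← hcount]
  push_cast
  rfl
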